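/- Let $\mathcal A$ be a C*-algebra of compact operators, i.e. $\mathcal A$ is (isomorphic to) a C*-subalgebra of the algebra $\mathcal K(H)$ of compact operators on some complex Hilbert space $H$. Let $E$ be a (right) Hilbert C*-module over $\mathcal A$, let $\mathcal L(E)$ be the algebra of adjointable operators on $E$, i.e. of the bounded $\mathcal A$-linear maps $T:E\to E$ for which there is $T^*:E\to E$ with $\langle Tx,y\rangle=\langle x,T^*y\rangle$ for all $x,y\in E$, and let $I$ be the identity of $E$. A closed submodule $W$ of $E$ is called nontrivial if $\{0\}\neq W\neq E$, and $T$-invariant if $T(W)\subseteq W$. Let $T\in\mathcal L(E)$ and consider the following assertions. 1. $T$ has a nontrivial invariant closed submodule. 2. There exists a nontrivial projection $P\in\mathcal L(E)$ (that is, $P=P^2=P^*$ and $0\neq P\neq I$) such that $PTP=TP$. 3. The operator equation $STS=TS$ has a solution $S\in\mathcal L(E)$ with $0\neq S\neq I$. Then (1) and (2) are equivalent. If moreover $T\neq 0$, or if $E$ has at least one nontrivial closed submodule, then (1), (2) and (3) are pairwise equivalent. -/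

import Mathlib

/-! Hilbert C⋆-modules are Mathlib's `CStarModule B E` with `E` complete.  In Mathlib's convention
`B` acts by `b • x`, and the `B`-valued inner product is conjugate-linear in the first variable,
with `⟪x, b • y⟫ = b * ⟪x, y⟫`.  A *right* Hilbert `A`-module is therefore a
`CStarModule Aᵐᵒᵖ E`: the right action is `x · a = MulOpposite.op a • x`, and the `A`-valued
inner product `⟨x, y⟩ = MulOpposite.unop (inner Aᵐᵒᵖ x y)` satisfies `⟨x, y · a⟩ = ⟨x, y⟩ * a`.
The definitions below are stated for an arbitrary coefficient algebra `B`. -/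

section HilbertModule

variable (B : Type*) {E : Type*} [NonUnitalCStarAlgebra B] [PartialOrder B]
  [NormedAddCommGroup E] [NormedSpace ℂ E] [SMul B E]

/-- A norm-closed complex linear subspace that is stable under the action of `B`.  It is called
nontrivial if it is neither `⊥` nor `⊤`. -/
structure IsClosedSubmodule (W : Submodule ℂ E) : Prop where
  isClosed : IsClosed (W : Set E)
  smul_mem : ∀ (b : B), ∀ x ∈ W, b • x ∈ W

variable [CStarModule B E]

/-- `T'` is an adjoint of `T` for the `B`-valued inner product. -/
def IsAdjointOf (T' T : E → E) : Prop :=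
  ∀ x y : E, inner B (T x) y = inner B x (T' y)

variable (E) in
/-- The algebra `𝓛(E)` of adjointable operators on `E`: the (bounded) module maps `T : E → E`
that have an adjoint `T'`. -/
def adjointableOperators : Subalgebra ℂ (E →L[ℂ] E) where
  carrier := {T | (∀ (b : B) (x : E), T (b • x) = b • T x) ∧ ∃ T' : E → E, IsAdjointOf B T' T}
  mul_mem' := by
    rintro S T ⟨hS, S', hS'⟩ ⟨hT, T', hT'⟩
    refine ⟨fun b x => by simp [hS, hT], T' ∘ S', fun x y => ?_⟩
    have h1 := hS' (T x) y
    have h2 := hT' x (S' y)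
    simpa using h1.trans h2
  add_mem' := by
    rintro S T ⟨hS, S', hS'⟩ ⟨hT, T', hT'⟩
    refine ⟨fun b x => ?_, fun x => S' x + T' x, fun x y => ?_⟩
    · have key : ∀ z : E, inner B z (b • (S x + T x)) = inner B z (b • S x + b • T x) := by
        intro z
        simp [mul_add]
      rw [add_apply, add_apply, hS, hT]
      have h := key (b • (S x + T x) - (b • S x + b • T x))
      rw [← sub_eq_zero, ← CStarModule.inner_sub_right, CStarModule.inner_self, sub_eq_zero] at h
      exact h.symm
    · have h1 := hS' x y
      have h2 := hT' x y
      simp [h1, h2]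
  algebraMap_mem' := by
    intro c
    refine ⟨fun b x => ?_, fun x => star c • x, fun x y => ?_⟩
    · have key : ∀ z : E, inner B z (c • b • x) = inner B z (b • c • x) := by
        intro z
        simp [mul_smul_comm]
      have h := key (c • b • x - b • c • x)
      rw [← sub_eq_zero, ← CStarModule.inner_sub_right, CStarModule.inner_self, sub_eq_zero] at h
      simpa [Algebra.algebraMap_eq_smul_one] using h
    · simp [Algebra.algebraMap_eq_smul_one]

/-- A closed submodule `W` with `T(W) ⊆ W`. -/
structure IsInvariantSubmodule (T : adjointableOperators B E) (W : Submodule ℂ E) : Prop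
    extends IsClosedSubmodule B W where
  map_mem : ∀ x ∈ W, (T : E →L[ℂ] E) x ∈ W

/-- `P = P * P` and `P` is its own adjoint. -/
structure IsOrthogonalProjection (P : adjointableOperators B E) : Prop where
  mul_self : P * P = P
  self_adjoint : IsAdjointOf B (P : E →L[ℂ] E) (P : E →L[ℂ] E)

end HilbertModule

/-! Everything rests on `sup_orthogonal_eq_top`: over compact operators every closed submodule `W`
is orthogonally complemented. Then (1) gives (2) through the projection onto `W`, and (3) gives (1)
through kernels of `S - 1` and `T`.

Since `W ⊔ W^⊥` is closed, it suffices to decompose a dense set of vectors `y`. Compactness makes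
dense those whose inner products live on a finite-dimensional `F ⊆ H` (`exists_supported_near`). On
vectors supported on `F`, the trace over `F` of the operator-valued inner product is a scalar inner
product whose norm is equivalent to the module norm, so Riesz gives `w ∈ W` with `y - w`
trace-orthogonal to the supported part of `W`. Testing against `v · ⟨v, y - w⟩`, for `v ∈ W`,
upgrades this to `⟨v, y - w⟩ = 0`. -/

section Riesz

/-- The Riesz representation theorem for a Hilbert form whose norm is equivalent to the given
Banach space norm. -/
theorem InnerProductSpace.Core.exists_riesz {D G : Type*} [NormedAddCommGroup D] [NormedSpace ℂ D]
    [CompleteSpace D] [AddCommGroup G] [Module ℂ G] (cd : InnerProductSpace.Core ℂ G)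
    (e : D ≃ₗ[ℂ] G) (C : ℝ)
    (h₁ : ∀ v, ‖v‖ ≤ C * √(cd.inner (e v) (e v)).re)
    (h₂ : ∀ v, √(cd.inner (e v) (e v)).re ≤ C * ‖v‖) (f : D →L[ℂ] ℂ) :
    ∃ w, ∀ v, cd.inner (e w) (e v) = f v := by
  let _ : NormedAddCommGroup G := cd.toNormedAddCommGroup
  let _ : InnerProductSpace ℂ G := InnerProductSpace.ofCore cd.toCore
  let e' : D ≃L[ℂ] G := e.toContinuousLinearEquivOfBounds C C h₂
    (fun y => by
      have h := h₁ (e.symm y)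
      rwa [e.apply_symm_apply] at h)
  have : CompleteSpace G := (completeSpace_congr (e := e'.toEquiv) e'.isUniformEmbedding).mp inferInstance
  let g : StrongDual ℂ G := f.comp (e'.symm : G →L[ℂ] D)
  refine ⟨e.symm ((InnerProductSpace.toDual ℂ G).symm g), fun v => ?_⟩
  have := InnerProductSpace.toDual_symm_apply (𝕜 := ℂ) (x := e v) (y := g)
  rw [e.apply_symm_apply]
  refine this.trans ?_
  change f (e.symm (e v)) = f v
  simp

end Riesz

/-! ### Fixed vectors, orthogonal complements and projections -/

namespace CStarModule

section General

variable {B E : Type*} [NonUnitalCStarAlgebra B] [PartialOrder B]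
  [NormedAddCommGroup E] [NormedSpace ℂ E] [SMul B E] [CStarModule B E]

-- `SMul B E` brings no module laws; they are recovered by testing against inner products, which
-- separate points.
variable (B) in
theorem ext_inner_left' {x y : E} (h : ∀ z, inner B z x = inner B z y) : x = y := by
  have h := h (x - y)
  rwa [← sub_eq_zero, ← inner_sub_right, inner_self, sub_eq_zero] at h

theorem smul_zero' (b : B) : b • (0 : E) = 0 := ext_inner_left' B fun z => by simp

theorem map_smul_of_isAdjointOf {T T' : E → E} (h : IsAdjointOf B T' T) (b : B) (x : E) :
    T' (b • x) = b • T' x :=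
  ext_inner_left' B fun z => by simp [← h z]

/-- The fixed vectors of an adjointable operator. -/
def fixedSubmodule (S : adjointableOperators B E) : Submodule ℂ E :=
  LinearMap.ker ((S : E →L[ℂ] E) - 1).toLinearMap

theorem mem_fixedSubmodule {S : adjointableOperators B E} {x : E} :
    x ∈ fixedSubmodule S ↔ (S : E →L[ℂ] E) x = x := by
  simp [fixedSubmodule, sub_eq_zero]

theorem isInvariantSubmodule_fixedSubmodule {S T : adjointableOperators B E}
    (h : S * T * S = T * S) : IsInvariantSubmodule B T (fixedSubmodule S) where
  isClosed := ((S : E →L[ℂ] E) - 1).isClosed_ker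
  smul_mem b x hx := by
    rw [mem_fixedSubmodule] at hx ⊢
    rw [S.2.1, hx]
  map_mem x hx := by
    rw [mem_fixedSubmodule] at hx ⊢
    have := congrArg (fun R : adjointableOperators B E => (R : E →L[ℂ] E) x) h
    simpa [hx] using this

theorem fixedSubmodule_ne_top {S : adjointableOperators B E} (h : S ≠ 1) :
    fixedSubmodule S ≠ ⊤ := by
  refine fun h' => h (Subtype.ext (ContinuousLinearMap.ext fun x => ?_))
  exact mem_fixedSubmodule.mp (h' ▸ Submodule.mem_top)

theorem isInvariantSubmodule_ker (T : adjointableOperators B E) :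
    IsInvariantSubmodule B T (LinearMap.ker (T : E →L[ℂ] E).toLinearMap) where
  isClosed := (T : E →L[ℂ] E).isClosed_ker
  smul_mem b x hx := by
    have hx : (T : E →L[ℂ] E) x = 0 := hx
    change (T : E →L[ℂ] E) (b • x) = 0
    rw [T.2.1, hx, smul_zero']
  map_mem x hx := by
    have hx : (T : E →L[ℂ] E) x = 0 := hx
    rw [hx]
    exact zero_mem _

theorem adjointable_ne_zero_iff {S : adjointableOperators B E} :
    S ≠ 0 ↔ ∃ x, (S : E →L[ℂ] E) x ≠ 0 := by
  rw [← not_forall_not, not_iff_not]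
  simp only [not_not]
  exact ⟨fun h x => by simp [h], fun h => Subtype.ext (ContinuousLinearMap.ext h)⟩

/-- The equation puts the range of `T * S` inside the fixed vectors of `S`. If these vanish, then `T
* S = 0`, so `ker T` contains the nonzero range of `S`; it is proper unless `T = 0`, when any closed
submodule is invariant. -/
theorem exists_invariant_of_mul_mul_eq {S T : adjointableOperators B E} (h0 : S ≠ 0) (h1 : S ≠ 1)
    (h : S * T * S = T * S)
    (hT : T ≠ 0 ∨ ∃ W : Submodule ℂ E, IsClosedSubmodule B W ∧ W ≠ ⊥ ∧ W ≠ ⊤) :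
    ∃ W : Submodule ℂ E, IsInvariantSubmodule B T W ∧ W ≠ ⊥ ∧ W ≠ ⊤ := by
  by_cases hS : fixedSubmodule S = ⊥
  · by_cases hT0 : T = 0
    · obtain ⟨W, hW, hW'⟩ := hT.resolve_left (not_not.mpr hT0)
      exact ⟨W, ⟨hW, fun x _ => by simp [hT0]⟩, hW'⟩
    · refine ⟨_, isInvariantSubmodule_ker T, ?_, ?_⟩
      · obtain ⟨x, hx⟩ := adjointable_ne_zero_iff.mp h0
        refine (Submodule.ne_bot_iff _).mpr ⟨_, ?_, hx⟩
        have : (T : E →L[ℂ] E) ((S : E →L[ℂ] E) x) ∈ fixedSubmodule S := mem_fixedSubmodule.mpr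
          (congrArg (fun R : adjointableOperators B E => (R : E →L[ℂ] E) x) h)
        rw [hS] at this
        exact this
      · obtain ⟨x, hx⟩ := adjointable_ne_zero_iff.mp hT0
        exact fun h' => hx (h' ▸ Submodule.mem_top : x ∈ LinearMap.ker (T : E →L[ℂ] E).toLinearMap)
  · exact ⟨_, isInvariantSubmodule_fixedSubmodule h, hS, fixedSubmodule_ne_top h1⟩

theorem exists_invariant_of_projection {P T : adjointableOperators B E}
    (hP : IsOrthogonalProjection B P) (h0 : P ≠ 0) (h1 : P ≠ 1) (h : P * T * P = T * P) :
    ∃ W : Submodule ℂ E, IsInvariantSubmodule B T W ∧ W ≠ ⊥ ∧ W ≠ ⊤ := by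
  refine ⟨_, isInvariantSubmodule_fixedSubmodule h, ?_, fixedSubmodule_ne_top h1⟩
  obtain ⟨x, hx⟩ := adjointable_ne_zero_iff.mp h0
  exact (Submodule.ne_bot_iff _).mpr ⟨_, mem_fixedSubmodule.mpr
    (congrArg (fun R : adjointableOperators B E => (R : E →L[ℂ] E) x) hP.mul_self), hx⟩

/-- The orthogonal complement for the `B`-valued inner product. -/
def orthogonal (B : Type*) {E : Type*} [NonUnitalCStarAlgebra B] [PartialOrder B]
    [NormedAddCommGroup E] [NormedSpace ℂ E] [SMul B E] [CStarModule B E]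
    (W : Submodule ℂ E) : Submodule ℂ E where
  carrier := {x | ∀ v ∈ W, inner B v x = 0}
  add_mem' hx hy v hv := by simp [hx v hv, hy v hv]
  zero_mem' v _ := by simp
  smul_mem' c x hx v hv := by simp [hx v hv]

theorem mem_orthogonal {W : Submodule ℂ E} {x : E} :
    x ∈ orthogonal B W ↔ ∀ v ∈ W, inner B v x = 0 := Iff.rfl

theorem inner_eq_zero_of_mem_orthogonal {W : Submodule ℂ E} {x v : E}
    (hx : x ∈ orthogonal B W) (hv : v ∈ W) : inner B x v = 0 := by
  rw [← star_inner, hx v hv, star_zero]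

theorem disjoint_orthogonal (W : Submodule ℂ E) : Disjoint W (orthogonal B W) :=
  Submodule.disjoint_def.mpr fun x hx hx' => inner_self.mp (hx' x hx)

variable [StarOrderedRing B]

theorem isClosed_orthogonal (W : Submodule ℂ E) : IsClosed (orthogonal B W : Set E) := by
  have : (orthogonal B W : Set E) = ⋂ v ∈ W, (innerSL (A := B) v) ⁻¹' {0} := by
    ext x
    simp [mem_orthogonal, innerSL_apply]
  rw [this]
  exact isClosed_biInter fun v _ => isClosed_singleton.preimage (innerSL (A := B) v).continuous

/-- Pythagoras in `B`: the cross terms vanish and the `y` term is positive. -/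
theorem norm_le_norm_add_of_mem_orthogonal {W : Submodule ℂ E} {w y : E} (hw : w ∈ W)
    (hy : y ∈ orthogonal B W) : ‖w‖ ≤ ‖w + y‖ := by
  refine (pow_le_pow_iff_left₀ (norm_nonneg _) (norm_nonneg _) two_ne_zero).mp ?_
  rw [norm_sq_eq B, norm_sq_eq B]
  refine CStarAlgebra.norm_le_norm_of_nonneg_of_le inner_self_nonneg ?_
  simp [hy w hw, inner_eq_zero_of_mem_orthogonal hy hw, inner_self_nonneg]

theorem isClosed_sup_orthogonal [CompleteSpace E] {W : Submodule ℂ E}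
    (hW : IsClosed (W : Set E)) : IsClosed ((W ⊔ orthogonal B W : Submodule ℂ E) : Set E) := by
  have := hW.completeSpace_coe
  have := (isClosed_orthogonal (B := B) W).completeSpace_coe
  let f : (W × orthogonal B W) →L[ℂ] E := W.subtypeL.coprod (orthogonal B W).subtypeL
  -- `‖w‖ ≤ ‖w + y‖` and the triangle inequality give `‖y‖ ≤ 2‖w + y‖`.
  have hf : AntilipschitzWith 2 f := by
    refine f.antilipschitz_of_bound fun p => ?_
    have h1 : ‖(p.1 : E)‖ ≤ ‖(p.1 : E) + p.2‖ :=
      norm_le_norm_add_of_mem_orthogonal p.1.2 p.2.2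
    have h2 : ‖(p.2 : E)‖ ≤ ‖(p.1 : E) + p.2‖ + ‖(p.1 : E)‖ := by
      simpa using norm_sub_le ((p.1 : E) + p.2) (p.1 : E)
    have h3 : f p = (p.1 : E) + p.2 := by simp [f]
    rw [h3, Prod.norm_def]
    refine max_le ?_ ?_ <;> simp only [Submodule.coe_norm, NNReal.coe_ofNat] <;>
      linarith [norm_nonneg (p.1 : E)]
  have := hf.isClosed_range f.uniformContinuous
  convert this
  ext x
  simp [Submodule.mem_sup, f]

/-- A closed submodule with an orthogonal complement is the range of a projection. -/
theorem exists_projection {W : Submodule ℂ E} (h : W ⊔ orthogonal B W = ⊤) :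
    ∃ P : adjointableOperators B E, IsOrthogonalProjection B P ∧
      (∀ x, (P : E →L[ℂ] E) x ∈ W) ∧ ∀ x ∈ W, (P : E →L[ℂ] E) x = x := by
  have hc : IsCompl W (orthogonal B W) := ⟨disjoint_orthogonal W, codisjoint_iff.mpr h⟩
  let p : E →ₗ[ℂ] E := W.projection _ hc
  have hpW : ∀ x, p x ∈ W := fun x => Submodule.projection_apply_mem hc x
  have hpx : ∀ x ∈ W, p x = x := fun x hx => Submodule.projection_apply_left hc ⟨x, hx⟩
  have hpo : ∀ x, x - p x ∈ orthogonal B W := Submodule.sub_projection_mem hc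
  have hbound : ∀ x, ‖p x‖ ≤ 1 * ‖x‖ := fun x => by
    simpa using norm_le_norm_add_of_mem_orthogonal (hpW x) (hpo x)
  have hadj : IsAdjointOf B p p := fun x y => by
    have h1 := hpo y _ (hpW x)
    have h2 := inner_eq_zero_of_mem_orthogonal (hpo x) (hpW y)
    rw [inner_sub_right, sub_eq_zero] at h1
    rw [inner_sub_left, sub_eq_zero] at h2
    rw [h1, h2]
  refine ⟨⟨p.mkContinuous 1 hbound, map_smul_of_isAdjointOf hadj, p, hadj⟩, ⟨?_, hadj⟩, hpW, hpx⟩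
  exact Subtype.ext (ContinuousLinearMap.ext fun x => hpx _ (hpW x))

theorem exists_projection_of_invariant {T : adjointableOperators B E} {W : Submodule ℂ E}
    (h : W ⊔ orthogonal B W = ⊤) (hT : ∀ x ∈ W, (T : E →L[ℂ] E) x ∈ W) (h0 : W ≠ ⊥) (h1 : W ≠ ⊤) :
    ∃ P : adjointableOperators B E,
      IsOrthogonalProjection B P ∧ P ≠ 0 ∧ P ≠ 1 ∧ P * T * P = T * P := by
  obtain ⟨P, hP, hPW, hPx⟩ := exists_projection h
  refine ⟨P, hP, ?_, ?_, Subtype.ext (ContinuousLinearMap.ext fun x => hPx _ (hT _ (hPW x)))⟩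
  · rintro rfl
    exact h0 ((Submodule.eq_bot_iff _).mpr fun x hx => (hPx x hx).symm)
  · rintro rfl
    exact h1 (Submodule.eq_top_iff'.mpr hPW)

end General

end CStarModule

/-! ### Norm bound for operators of finite support -/

section FiniteRank

open scoped InnerProductSpace

variable {H : Type*} [NormedAddCommGroup H] [InnerProductSpace ℂ H]

theorem ContinuousLinearMap.norm_le_sum_of_forall_orthogonal {ι : Type*} [Fintype ι]
    {F : Submodule ℂ H} [F.HasOrthogonalProjection] (u : OrthonormalBasis ι ℂ F) (T : H →L[ℂ] H)
    (hT : ∀ ξ ∈ Fᗮ, T ξ = 0) : ‖T‖ ≤ ∑ i, ‖T (u i)‖ := by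
  refine T.opNorm_le_bound (Finset.sum_nonneg fun _ _ => norm_nonneg _) fun ξ => ?_
  have h1 : T ξ = T (F.orthogonalProjectionOnto ξ : H) := by
    rw [← sub_eq_zero, ← map_sub]
    exact hT _ (F.sub_starProjection_mem_orthogonal ξ)
  have h2 := congrArg (Subtype.val) (u.sum_repr' (F.orthogonalProjectionOnto ξ))
  rw [h1, ← h2, Submodule.coe_sum, map_sum, Finset.sum_mul]
  refine (norm_sum_le _ _).trans (Finset.sum_le_sum fun i _ => ?_)
  rw [Submodule.coe_smul, map_smul, norm_smul, mul_comm]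
  refine mul_le_mul_of_nonneg_left ?_ (norm_nonneg _)
  refine (norm_inner_le_norm _ _).trans ?_
  rw [u.norm_eq_one, one_mul]
  exact F.norm_orthogonalProjectionOnto_apply_le ξ

end FiniteRank

/-! ### The trace form and approximation in a closed submodule -/

namespace CStarModule

open MulOpposite
open scoped InnerProductSpace

variable {A : Type*} [NonUnitalCStarAlgebra A] [PartialOrder A]
  {H : Type*} [NormedAddCommGroup H] [InnerProductSpace ℂ H] [CompleteSpace H]
  {E : Type*} [NormedAddCommGroup E] [NormedSpace ℂ E] [SMul Aᵐᵒᵖ E] [CStarModule Aᵐᵒᵖ E]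
  (φ : A →⋆ₙₐ[ℂ] (H →L[ℂ] H))

/-- The operator-valued inner product obtained from a representation of the coefficients. -/
noncomputable def opForm (x y : E) : H →L[ℂ] H := φ (unop (inner Aᵐᵒᵖ x y))

theorem opForm_add_right (x y z : E) : opForm φ x (y + z) = opForm φ x y + opForm φ x z := by
  simp [opForm]

theorem opForm_add_left (x y z : E) : opForm φ (x + y) z = opForm φ x z + opForm φ y z := by
  simp [opForm]

theorem opForm_sub_left (x y z : E) : opForm φ (x - y) z = opForm φ x z - opForm φ y z := by
  simp [opForm]

theorem opForm_smul_right (c : ℂ) (x y : E) : opForm φ x (c • y) = c • opForm φ x y := by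
  simp [opForm]

theorem opForm_smul_left (c : ℂ) (x y : E) : opForm φ (c • x) y = star c • opForm φ x y := by
  simp [opForm]

theorem opForm_zero_right (x : E) : opForm φ x 0 = 0 := by
  simp [opForm]

theorem opForm_action_right (b : Aᵐᵒᵖ) (x y : E) :
    opForm φ x (b • y) = opForm φ x y * φ (unop b) := by
  simp [opForm]

theorem star_opForm (x y : E) : star (opForm φ x y) = opForm φ y x := by
  rw [opForm, ← map_star, ← unop_star, star_inner, opForm]

variable {φ} in
theorem opForm_eq_zero_iff (hφ : Function.Injective φ) {x y : E} :
    opForm φ x y = 0 ↔ inner Aᵐᵒᵖ x y = 0 := by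
  rw [opForm, map_eq_zero_iff φ hφ, unop_eq_zero_iff]

variable {φ} in
theorem norm_opForm_self (hφ : Function.Injective φ) (x : E) : ‖opForm φ x x‖ = ‖x‖ ^ 2 := by
  rw [opForm, NonUnitalStarAlgHom.norm_map φ hφ, norm_unop, norm_sq_eq Aᵐᵒᵖ]

theorem unop_inner_self_nonneg (x : E) : 0 ≤ unop (inner Aᵐᵒᵖ x x) :=
  inner_self_nonneg (A := Aᵐᵒᵖ) (x := x)

theorem _root_.ContinuousLinearMap.inner_star_mul_self_apply (b : H →L[ℂ] H) (ξ : H) :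
    ⟪ξ, (star b * b) ξ⟫_ℂ = ((‖b ξ‖ ^ 2 : ℝ) : ℂ) := by
  rw [ContinuousLinearMap.star_eq_adjoint, mul_apply_eq_comp,
    ContinuousLinearMap.adjoint_inner_right, inner_self_eq_norm_sq_to_K]
  simp

/-- The vectors whose operator-valued inner products vanish on `Fᗮ`. -/
noncomputable def supportedSubmodule (F : Submodule ℂ H) : Submodule ℂ E where
  carrier := {v | ∀ z : E, ∀ ξ ∈ Fᗮ, opForm φ z v ξ = 0}
  add_mem' hx hy z ξ hξ := by simp [opForm_add_right, hx z ξ hξ, hy z ξ hξ]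
  zero_mem' z ξ _ := by simp [opForm_zero_right]
  smul_mem' c x hx z ξ hξ := by simp [opForm_smul_right, hx z ξ hξ]

variable {ι : Type*} [Fintype ι]

/-- The trace form of the operator-valued inner product over a finite family of vectors. -/
noncomputable def traceForm (u : ι → H) (x y : E) : ℂ := ∑ i, ⟪u i, opForm φ x y (u i)⟫_ℂ

theorem conj_traceForm (u : ι → H) (x y : E) :
    (starRingEnd ℂ) (traceForm φ u x y) = traceForm φ u y x := by
  simp_rw [traceForm, map_sum, inner_conj_symm]
  refine Finset.sum_congr rfl fun i _ => ?_
  rw [← star_opForm φ x y, ContinuousLinearMap.star_eq_adjoint,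
    ContinuousLinearMap.adjoint_inner_right]

theorem traceForm_eq_sum {u : ι → H} {x y : E} {b : H →L[ℂ] H}
    (hb : opForm φ x y = star b * b) : traceForm φ u x y = ((∑ i, ‖b (u i)‖ ^ 2 : ℝ) : ℂ) := by
  rw [traceForm, hb, Complex.ofReal_sum]
  exact Finset.sum_congr rfl fun i _ => b.inner_star_mul_self_apply _

variable [StarOrderedRing A]

theorem norm_opForm_le (x y : E) : ‖opForm φ x y‖ ≤ ‖x‖ * ‖y‖ :=
  (NonUnitalStarAlgHom.norm_apply_le φ _).trans
    (by rw [norm_unop]; exact norm_inner_le (A := Aᵐᵒᵖ) E)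

theorem exists_opForm_self_eq (x : E) : ∃ b : H →L[ℂ] H, opForm φ x x = star b * b := by
  obtain ⟨b, hb⟩ := CStarAlgebra.nonneg_iff_eq_star_mul_self.mp (unop_inner_self_nonneg (A := A) x)
  exact ⟨φ b, by rw [opForm, hb, map_mul, map_star]⟩

theorem continuous_opForm_right (z : E) : Continuous fun v => opForm φ z v :=
  AddMonoidHomClass.continuous_of_bound
    (AddMonoidHom.mk' (fun v => opForm φ z v) (opForm_add_right φ z)) ‖z‖ (norm_opForm_le φ z)

theorem isClosed_supportedSubmodule (F : Submodule ℂ H) :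
    IsClosed ((supportedSubmodule φ F : Submodule ℂ E) : Set E) := by
  have : ((supportedSubmodule φ F : Submodule ℂ E) : Set E) =
      ⋂ (z : E) (ξ ∈ Fᗮ), {v | opForm φ z v ξ = 0} := by
    ext v
    simp [supportedSubmodule]
  rw [this]
  refine isClosed_iInter fun z => isClosed_biInter fun ξ _ => ?_
  exact isClosed_eq ((ContinuousLinearMap.apply ℂ H ξ).continuous.comp
    (continuous_opForm_right φ z)) continuous_const

theorem traceForm_self_re_nonneg (u : ι → H) (x : E) : 0 ≤ (traceForm φ u x x).re := by
  obtain ⟨b, hb⟩ := exists_opForm_self_eq φ x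
  rw [traceForm_eq_sum φ hb, Complex.ofReal_re]
  positivity

theorem norm_traceForm_le {F : Submodule ℂ H} (u : OrthonormalBasis ι ℂ F) (x y : E) :
    ‖traceForm φ (fun i => (u i : H)) x y‖ ≤ Fintype.card ι * ‖x‖ * ‖y‖ := by
  have hu : ∀ i, ‖(u i : H)‖ = 1 := fun i => u.norm_eq_one i
  calc _ ≤ ∑ i : ι, ‖x‖ * ‖y‖ := by
        refine norm_sum_le_of_le _ fun i _ => (norm_inner_le_norm _ _).trans ?_
        rw [hu, one_mul]
        refine ((opForm φ x y).le_opNorm _).trans ?_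
        rw [hu, mul_one]
        exact norm_opForm_le φ x y
    _ = _ := by simp [mul_assoc]

variable {φ} in
theorem norm_le_sqrt_traceForm (hφ : Function.Injective φ) {F : Submodule ℂ H}
    [F.HasOrthogonalProjection] (u : OrthonormalBasis ι ℂ F) {x : E}
    (hx : x ∈ supportedSubmodule φ F) :
    ‖x‖ ≤ Fintype.card ι * √(traceForm φ (fun i => (u i : H)) x x).re := by
  obtain ⟨b, hb⟩ := exists_opForm_self_eq φ x
  -- `‖b ξ‖² = ⟪ξ, opForm φ x x ξ⟫`, so `b` inherits the support of `x`.
  have hker : ∀ ξ ∈ Fᗮ, b ξ = 0 := fun ξ hξ => by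
    have := b.inner_star_mul_self_apply ξ
    rw [← hb, hx x ξ hξ, _root_.inner_zero_right, eq_comm, Complex.ofReal_eq_zero] at this
    simpa using this
  have hnorm : ‖x‖ = ‖b‖ := by
    refine (pow_left_inj₀ (norm_nonneg _) (norm_nonneg _) two_ne_zero).mp ?_
    rw [← norm_opForm_self hφ, hb, CStarRing.norm_star_mul_self, sq]
  rw [hnorm, traceForm_eq_sum φ hb, Complex.ofReal_re]
  refine (b.norm_le_sum_of_forall_orthogonal u hker).trans ?_
  rw [← nsmul_eq_mul, ← Finset.card_univ]
  refine Finset.sum_le_card_nsmul _ _ _ fun i _ => Real.le_sqrt_of_sq_le ?_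
  exact Finset.single_le_sum (f := fun i => ‖b (u i)‖ ^ 2) (fun _ _ => by positivity)
    (Finset.mem_univ i)

theorem sqrt_traceForm_le {F : Submodule ℂ H} (u : OrthonormalBasis ι ℂ F) (x : E) :
    √(traceForm φ (fun i => (u i : H)) x x).re ≤ Fintype.card ι * ‖x‖ := by
  refine Real.sqrt_le_iff.mpr ⟨by positivity, ?_⟩
  refine (Complex.re_le_norm _).trans ((norm_traceForm_le φ u x x).trans ?_)
  -- The natural constant is `√n`; weakening it to `n` lets one constant serve both norm
  -- comparisons.
  have : (Fintype.card ι : ℝ) ≤ Fintype.card ι ^ 2 := by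
    exact_mod_cast Nat.le_self_pow two_ne_zero _
  nlinarith [mul_le_mul_of_nonneg_right this (sq_nonneg ‖x‖)]

variable {φ} in
/-- The best approximation of a vector of finite support in a closed submodule. -/
theorem mem_sup_orthogonal_of_mem_supportedSubmodule [CompleteSpace E]
    (hφ : Function.Injective φ) {W : Submodule ℂ E} (hW : IsClosedSubmodule Aᵐᵒᵖ W)
    (F : Submodule ℂ H) [FiniteDimensional ℂ F] {y : E} (hy : y ∈ supportedSubmodule φ F) :
    y ∈ W ⊔ orthogonal Aᵐᵒᵖ W := by
  let u := stdOrthonormalBasis ℂ F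
  let u' := fun i => (u i : H)
  let D : Submodule ℂ E := W ⊓ supportedSubmodule φ F
  have hD : IsClosed (D : Set E) := hW.isClosed.inter (isClosed_supportedSubmodule φ F)
  have := hD.completeSpace_coe
  have hDF : ∀ v : D, (v : E) ∈ supportedSubmodule φ F := fun v => (Submodule.mem_inf.mp v.2).2
  have hD₁ : ∀ v : D, ‖(v : E)‖ ≤ Fintype.card (Fin (Module.finrank ℂ F)) *
      √(traceForm φ u' (v : E) v).re := fun v => norm_le_sqrt_traceForm hφ u (hDF v)
  have hD₂ : ∀ v : D, √(traceForm φ u' (v : E) v).re ≤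
      Fintype.card (Fin (Module.finrank ℂ F)) * ‖(v : E)‖ := fun v => sqrt_traceForm_le φ u (v : E)
  let cd : InnerProductSpace.Core ℂ D :=
    { inner := fun v w => traceForm φ u' (v : E) w
      conj_inner_symm := fun v w => conj_traceForm φ u' (w : E) v
      re_inner_nonneg := fun v => traceForm_self_re_nonneg φ u' (v : E)
      add_left := fun v w z => by
        simp [traceForm, opForm_add_left, Finset.sum_add_distrib]
      smul_left := fun v w c => by
        simp [traceForm, opForm_smul_left, Finset.mul_sum]
      definite := fun v hv => by
        have := hD₁ v
        have hv : traceForm φ u' (v : E) v = 0 := hv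
        rw [hv] at this
        simpa using this }
  let f : D →L[ℂ] ℂ := LinearMap.mkContinuous
    { toFun := fun v => traceForm φ u' y v
      map_add' := fun v w => by
        simp [traceForm, opForm_add_right, Finset.sum_add_distrib]
      map_smul' := fun c v => by
        simp [traceForm, opForm_smul_right, Finset.mul_sum] }
    _ (fun v => norm_traceForm_le φ u y v)
  obtain ⟨w, hw⟩ := cd.exists_riesz (LinearEquiv.refl ℂ D) _ hD₁ hD₂ f
  have hyw : y - w ∈ supportedSubmodule φ F := sub_mem hy (hDF w)
  refine Submodule.mem_sup.mpr ⟨w, (Submodule.mem_inf.mp w.2).1, y - w, fun v hv => ?_, by simp⟩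
  -- This test vector lies in `W` because `v` does, and is supported on `F` because `y - w` is.
  -- Pairing it with `y - w` gives the positive operator `⟨v, y - w⟩* ⟨v, y - w⟩`, whose zero trace
  -- forces `⟨v, y - w⟩ = 0`.
  have hv' : (inner Aᵐᵒᵖ v (y - w) • v : E) ∈ D := by
    refine ⟨hW.smul_mem _ v hv, fun z ξ hξ => ?_⟩
    rw [opForm_action_right]
    change opForm φ z v (opForm φ v (y - w) ξ) = 0
    rw [hyw v ξ hξ, map_zero]
  have h1 : traceForm φ u' (w : E) _ = traceForm φ u' y _ := hw ⟨_, hv'⟩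
  have h2 : traceForm φ u' (y - w) (inner Aᵐᵒᵖ v (y - w) • v : E) = 0 := by
    rw [← sub_eq_zero.mpr h1.symm]
    simp [traceForm, opForm_sub_left, Finset.sum_sub_distrib]
  have h3 : opForm φ (y - w) (inner Aᵐᵒᵖ v (y - w) • v : E) =
      star (opForm φ v (y - w)) * opForm φ v (y - w) := by
    rw [opForm_action_right, star_opForm]
    rfl
  rw [traceForm_eq_sum φ h3, Complex.ofReal_eq_zero,
    Finset.sum_eq_zero_iff_of_nonneg fun _ _ => by positivity] at h2
  rw [← opForm_eq_zero_iff hφ, ← norm_le_zero_iff]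
  refine ((opForm φ v (y - w)).norm_le_sum_of_forall_orthogonal u (hyw v)).trans
    (Finset.sum_nonpos fun i hi => ?_)
  have := h2 i hi
  rw [sq_eq_zero_iff] at this
  exact this.le

end CStarModule

/-! ### Cutoffs by functional calculus -/

section Cutoff

/-- A continuous cutoff vanishing near zero, with a second cutoff equal to one on its support. -/
theorem CStarAlgebra.exists_cutoff {A : Type*} [NonUnitalCStarAlgebra A] [PartialOrder A]
    [StarOrderedRing A] {a : A} (ha : 0 ≤ a) {ε : ℝ} (hε : 0 < ε) :
    ∃ c d : A, IsSelfAdjoint c ∧ d * c = c ∧ ‖a - a * c - (c * a - c * a * c)‖ ≤ 2 * ε := by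
  have hsa : IsSelfAdjoint a := .of_nonneg ha
  obtain ⟨h, hh, hh0, hh1⟩ : ∃ h : ℝ → ℝ, Continuous h ∧ h 0 = 0 ∧ ∀ t, ε ≤ t → h t = 1 :=
    ⟨fun t => min 1 (t / ε), by fun_prop, by simp,
      fun t ht => min_eq_left ((one_le_div hε).mpr ht)⟩
  obtain ⟨g, hg, hg0, hg1, hgl, hgr⟩ : ∃ g : ℝ → ℝ, Continuous g ∧ (∀ t, 0 ≤ g t) ∧
      (∀ t, g t ≤ 1) ∧ (∀ t, t ≤ ε → g t = 0) ∧ ∀ t, 2 * ε ≤ t → g t = 1 := by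
    refine ⟨fun t => min 1 (max 0 (t / ε - 1)), by fun_prop,
      fun t => le_min zero_le_one (le_max_left _ _), fun t => min_le_left _ _,
      fun t ht => ?_, fun t ht => ?_⟩
    · simp [max_eq_left (sub_nonpos.mpr ((div_le_one hε).mpr ht))]
    · refine min_eq_left (le_max_of_le_right ?_)
      rw [le_sub_iff_add_le, le_div_iff₀ hε]
      linarith
  have hgz : g 0 = 0 := hgl 0 hε.le
  refine ⟨cfcₙ g a, cfcₙ h a, cfcₙ_predicate g a, ?_, ?_⟩
  · rw [← cfcₙ_mul h g a hh.continuousOn hh0 hg.continuousOn hgz]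
    refine cfcₙ_congr fun t _ => ?_
    rcases le_total t ε with hle | hle
    · simp [hgl t hle]
    · simp [hh1 t hle]
  · have h1 : Continuous fun t => t * g t := by fun_prop
    have h2 : Continuous fun t => g t * t := by fun_prop
    have h3 : Continuous fun t => g t * t * g t := by fun_prop
    have h4 : Continuous fun t => t - t * g t := by fun_prop
    have h5 : Continuous fun t => g t * t - g t * t * g t := by fun_prop
    have h6 : Continuous fun t : ℝ => t := continuous_id
    have e1 : cfcₙ (fun t : ℝ => t - t * g t - (g t * t - g t * t * g t)) a =
        a - a * cfcₙ g a - (cfcₙ g a * a - cfcₙ g a * a * cfcₙ g a) := by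
      rw [cfcₙ_sub (fun t => t - t * g t) (fun t => g t * t - g t * t * g t) a
          h4.continuousOn (by simp) h5.continuousOn (by simp),
        cfcₙ_sub (fun t => t) (fun t => t * g t) a h6.continuousOn rfl h1.continuousOn (by simp),
        cfcₙ_sub (fun t => g t * t) (fun t => g t * t * g t) a
          h2.continuousOn (by simp) h3.continuousOn (by simp),
        cfcₙ_mul (fun t => t) g a h6.continuousOn rfl hg.continuousOn hgz,
        cfcₙ_mul (fun t => g t * t) g a h2.continuousOn (by simp) hg.continuousOn hgz,
        cfcₙ_mul g (fun t => t) a hg.continuousOn hgz h6.continuousOn rfl, cfcₙ_id' ℝ a]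
    rw [← e1]
    refine norm_cfcₙ_le fun t ht => ?_
    have ht0 : 0 ≤ t := quasispectrum_nonneg_of_nonneg a ha t ht
    -- The element is `(1 - c) a (1 - c)` multiplied out, as `A` need not have a unit.
    have e2 : t - t * g t - (g t * t - g t * t * g t) = t * (1 - g t) ^ 2 := by ring
    rw [e2, Real.norm_of_nonneg (by positivity)]
    rcases le_total t (2 * ε) with hle | hle
    · calc t * (1 - g t) ^ 2 ≤ t * 1 := mul_le_mul_of_nonneg_left
            (pow_le_one₀ (by linarith [hg1 t]) (by linarith [hg0 t])) ht0
        _ ≤ 2 * ε := by linarith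
    · rw [hgr t hle]
      simp [hε.le]

end Cutoff

/-! ### Density of finite support and complementation -/

namespace CStarModule

open MulOpposite
open scoped InnerProductSpace

variable {A : Type*} [NonUnitalCStarAlgebra A] [PartialOrder A] [StarOrderedRing A]
  {H : Type*} [NormedAddCommGroup H] [InnerProductSpace ℂ H] [CompleteSpace H]
  {E : Type*} [NormedAddCommGroup E] [NormedSpace ℂ E] [SMul Aᵐᵒᵖ E] [CStarModule Aᵐᵒᵖ E]
  {φ : A →⋆ₙₐ[ℂ] (H →L[ℂ] H)}

/-- Over an algebra of compact operators, vectors with finite-dimensional support are dense. -/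
theorem exists_supported_near (hcompact : ∀ a : A, IsCompactOperator (φ a)) (x : E) {ε : ℝ}
    (hε : 0 < ε) : ∃ F : Submodule ℂ H, FiniteDimensional ℂ F ∧
      ∃ y ∈ supportedSubmodule φ F, ‖x - y‖ ^ 2 ≤ 2 * ε := by
  obtain ⟨c, d, hc, hdc, hnorm⟩ :=
    CStarAlgebra.exists_cutoff (unop_inner_self_nonneg (A := A) x) hε
  -- The eigenspace of the compact `φ d` at `1 ≠ 0` is finite-dimensional and, as `d * c = c`,
  -- contains the range of `φ c`; self-adjointness then makes `φ c` vanish on its complement.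
  refine ⟨Module.End.eigenspace (φ d).toLinearMap 1,
    (φ d).finite_dimensional_eigenspace (hcompact d) 1 one_ne_zero, op c • x,
    fun z ξ hξ => ?_, ?_⟩
  · rw [opForm_action_right, unop_op]
    have hcξ : φ c ξ = 0 := by
      refine ext_inner_left ℂ fun η => ?_
      have hη : φ c η ∈ Module.End.eigenspace (φ d).toLinearMap 1 := by
        rw [Module.End.mem_eigenspace_iff, one_smul]
        change (φ d * φ c) η = φ c η
        rw [← map_mul, hdc]
      have hsa : star (φ c) = φ c := by rw [← map_star, hc.star_eq]
      rw [_root_.inner_zero_right, ← hsa, ContinuousLinearMap.star_eq_adjoint,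
        ContinuousLinearMap.adjoint_inner_right]
      exact hξ _ hη
    change opForm φ z x (φ c ξ) = 0
    rw [hcξ, map_zero]
  · rw [norm_sq_eq Aᵐᵒᵖ, ← norm_unop]
    have key : unop (inner Aᵐᵒᵖ (x - op c • x) (x - op c • x)) =
        unop (inner Aᵐᵒᵖ x x) - unop (inner Aᵐᵒᵖ x x) * c -
          (c * unop (inner Aᵐᵒᵖ x x) - c * unop (inner Aᵐᵒᵖ x x) * c) := by
      simp [hc.star_eq, mul_assoc, mul_sub]
      abel
    rw [key]
    exact hnorm

/-- Over an algebra of compact operators every closed submodule is orthogonally complemented. -/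
theorem sup_orthogonal_eq_top [CompleteSpace E] (hφ : Function.Injective φ)
    (hcompact : ∀ a : A, IsCompactOperator (φ a)) {W : Submodule ℂ E}
    (hW : IsClosedSubmodule Aᵐᵒᵖ W) : W ⊔ orthogonal Aᵐᵒᵖ W = ⊤ := by
  refine Submodule.eq_top_iff'.mpr fun x => ?_
  refine (isClosed_sup_orthogonal (B := Aᵐᵒᵖ) hW.isClosed).closure_subset
    (Metric.mem_closure_iff.mpr fun δ hδ => ?_)
  -- This `ε` gives `‖x - y‖² ≤ δ² / 2 < δ²`.
  obtain ⟨F, _, y, hy, hxy⟩ := exists_supported_near hcompact x (ε := δ ^ 2 / 4) (by positivity)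
  refine ⟨y, mem_sup_orthogonal_of_mem_supportedSubmodule hφ hW F hy, ?_⟩
  rw [dist_eq_norm]
  exact lt_of_pow_lt_pow_left₀ 2 hδ.le (by nlinarith [sq_pos_of_pos hδ])

end CStarModule

theorem mainTheorem6
    {A : Type*} [NonUnitalCStarAlgebra A] [PartialOrder A] [StarOrderedRing A]
    -- `A` is a C⋆-algebra of compact operators on a Hilbert space `H`
    {H : Type*} [NormedAddCommGroup H] [InnerProductSpace ℂ H] [CompleteSpace H]
    (φ : A →⋆ₙₐ[ℂ] (H →L[ℂ] H)) (hφ : Function.Injective φ)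
    (hcompact : ∀ a : A, IsCompactOperator (φ a))
    -- `E` is a (right) Hilbert `A`-module
    {E : Type*} [NormedAddCommGroup E] [NormedSpace ℂ E] [CompleteSpace E] [SMul Aᵐᵒᵖ E]
    [CStarModule Aᵐᵒᵖ E]
    (T : adjointableOperators Aᵐᵒᵖ E) :
    -- an invariant submodule and a projection
    ((∃ W : Submodule ℂ E, IsInvariantSubmodule Aᵐᵒᵖ T W ∧ W ≠ ⊥ ∧ W ≠ ⊤) ↔
      (∃ P : adjointableOperators Aᵐᵒᵖ E,
        IsOrthogonalProjection Aᵐᵒᵖ P ∧ P ≠ 0 ∧ P ≠ 1 ∧ P * T * P = T * P)) ∧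
    -- a projection and a solution of the operator equation,
    -- unless `T = 0` and `E` has no nontrivial closed submodule at all
    ((T ≠ 0 ∨ ∃ W : Submodule ℂ E, IsClosedSubmodule Aᵐᵒᵖ W ∧ W ≠ ⊥ ∧ W ≠ ⊤) →
      ((∃ P : adjointableOperators Aᵐᵒᵖ E,
          IsOrthogonalProjection Aᵐᵒᵖ P ∧ P ≠ 0 ∧ P ≠ 1 ∧ P * T * P = T * P) ↔
        (∃ S : adjointableOperators Aᵐᵒᵖ E, S ≠ 0 ∧ S ≠ 1 ∧ S * T * S = T * S))) := by
  refine ⟨⟨?_, ?_⟩, fun hT => ⟨?_, ?_⟩⟩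
  · rintro ⟨W, hW, h0, h1⟩
    exact CStarModule.exists_projection_of_invariant
      (CStarModule.sup_orthogonal_eq_top hφ hcompact hW.toIsClosedSubmodule) hW.map_mem h0 h1
  · rintro ⟨P, hP, h0, h1, h⟩
    exact CStarModule.exists_invariant_of_projection hP h0 h1 h
  · rintro ⟨P, -, h⟩
    exact ⟨P, h⟩
  · rintro ⟨S, h0, h1, h⟩
    obtain ⟨W, hW, hW0, hW1⟩ := CStarModule.exists_invariant_of_mul_mul_eq h0 h1 h hT
    exact CStarModule.exists_projection_of_invariant
      (CStarModule.sup_orthogonal_eq_top hφ hcompact hW.toIsClosedSubmodule) hW.map_mem hW0 hW1
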